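/- Let $(X_i,Y_i)_{i\ge1}$ be i.i.d. random vectors with $X_i\in\mathbb R^d$ and $Y_i\in\mathbb R$, and fix $x\in\mathbb R^d$ with $p_0=P(X_1\le x)>0$ (componentwise inequality). Let $F(y)=P(Y_1\le y\mid X_1\le x)$, $q(\tau)=\inf\{y:F(y)\ge\tau\}$ and $z_1=\sup\{z:F(z)<1\}$. Assume: (a) $F$ belongs to the domain of attraction of type III generalized extreme value distributions with some index $\xi<0$: $z_1<\infty$ and, as $z\downarrow0$, $\frac{1-F(z_1-vz)}{1-F(z_1-z)}\to v^{-1/\xi}$ for every $v>0$; (b) the conditional law of $Y_1$ given $X_1\le x$ has a density $f_x\colon\mathbb R\to[0,\infty)$ that is monotone (nondecreasing or nonincreasing) on $[y_0,z_1)$ for some $y_0<z_1$; (c) $\tau_n\to1$, and $n(1-\tau_n)\to\infty$ polynomially in $n$, i.e. there are $\delta,c>0$ with $n(1-\tau_n)\ge c\,n^{\delta}$ for all large $n$. Let $\rho_\tau(u)=(\tau-\mathbf 1\{u\le0\})u$, and let $\hat q_n(\tau_n)$ be random variables such that, for all large $n$, $\hat q_n(\tau_n)$ is almost surely a minimizer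 over $q\in\mathbb R$ of $$\sum_{i=1}^n\rho_{\tau_n}(Y_i-q)\,\mathbf 1\{X_i\le x\}.$$ With $\lambda_n=n^{1/2}f_x(q(\tau_n))(1-\tau_n)^{-1/2}$, $$\lambda_n\bigl(\hat q_n(\tau_n)-q(\tau_n)\bigr)\rightsquigarrow N(0,p_0^{-1})\qquad(n\to\infty),$$ where $\rightsquigarrow$ denotes convergence in distribution. -/

import Mathlib

open MeasureTheory ProbabilityTheory Filter Topology

namespace Frontier

noncomputable section

/-- The distribution function `F(y / x) = P(Y ≤ y | X ≤ x)` of the output `Y` conditional on the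
event that the input vector `X` is componentwise at most `x`. -/
def condDistFun {Ω : Type*} [MeasurableSpace Ω] (P : Measure Ω) {d : ℕ}
    (X : Ω → Fin d → ℝ) (Y : Ω → ℝ) (x : Fin d → ℝ) (y : ℝ) : ℝ :=
  (P[|{ω | X ω ≤ x}]).real {ω | Y ω ≤ y}

/-- The quantile `inf {y : F y ≥ τ}` of a distribution function `F`. -/
def quantile (F : ℝ → ℝ) (τ : ℝ) : ℝ := sInf {y | τ ≤ F y}

/-- The upper endpoint `sup {z : F z < 1}` of a distribution function `F`. -/
def upperEndpoint (F : ℝ → ℝ) : ℝ := sSup {z | F z < 1}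

/-- `F` belongs to the domain of attraction of type III generalized extreme value distributions
with extreme value index `ξ < 0`: its upper endpoint `z₁` is finite and, as `z ↓ 0`,
`(1 - F (z₁ - v z)) / (1 - F (z₁ - z)) → v ^ (-1 / ξ)` for every `v > 0`. -/
def InTypeIIIDomain (F : ℝ → ℝ) (ξ : ℝ) : Prop :=
  ξ < 0 ∧ BddAbove {z | F z < 1} ∧
    ∀ v : ℝ, 0 < v →
      Tendsto (fun z => (1 - F (upperEndpoint F - v * z)) / (1 - F (upperEndpoint F - z)))
        (𝓝[>] 0) (𝓝 (v ^ (-1 / ξ)))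

/-- `f` is a density of the conditional law of `Y` given `X ≤ x`. -/
def IsCondDensity {Ω : Type*} [MeasurableSpace Ω] (P : Measure Ω) {d : ℕ}
    (X : Ω → Fin d → ℝ) (Y : Ω → ℝ) (x : Fin d → ℝ) (f : ℝ → ℝ) : Prop :=
  Measurable f ∧ (∀ y, 0 ≤ f y) ∧
    (P[|{ω | X ω ≤ x}]).map Y = volume.withDensity (fun y => ENNReal.ofReal (f y))

/-- `f` is monotone (in either direction) in the upper tail, on `[y₀, z₁)` for some `y₀`
strictly below the upper endpoint `z₁`. -/
def EventuallyMonotoneBelow (f : ℝ → ℝ) (z₁ : ℝ) : Prop :=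
  ∃ y₀ < z₁, MonotoneOn f (Set.Ico y₀ z₁) ∨ AntitoneOn f (Set.Ico y₀ z₁)

/-- Intermediate quantile indices: `τ n → 1` while `n (1 - τ n) → ∞` at least as fast as
some positive power of `n`. -/
def IsIntermediate (τ : ℕ → ℝ) : Prop :=
  Tendsto τ atTop (𝓝 1) ∧
    ∃ δ : ℝ, 0 < δ ∧ ∃ c : ℝ, 0 < c ∧ ∀ᶠ n : ℕ in atTop, c * (n : ℝ) ^ δ ≤ n * (1 - τ n)

/-- The check function `ρ_τ(u) = (τ - 1{u ≤ 0}) u`. -/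
def check (τ u : ℝ) : ℝ := (τ - if u ≤ 0 then 1 else 0) * u

open Classical in
/-- The sample objective `∑_{i < n} ρ_τ(Y_i - q) 1{X_i ≤ x}`, a function of `q`, at the
realization `ω`. -/
def sampleObjective {Ω : Type*} {d : ℕ} (X : ℕ → Ω → Fin d → ℝ) (Y : ℕ → Ω → ℝ)
    (x : Fin d → ℝ) (n : ℕ) (τ : ℝ) (ω : Ω) (q : ℝ) : ℝ :=
  ∑ i ∈ Finset.range n, check τ (Y i ω - q) * if X i ω ≤ x then 1 else 0

/-- The normalizing rate `n^{1/2} f(q(τ)) (1 - τ)^{-1/2}`. -/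
def rate (F f : ℝ → ℝ) (n : ℕ) (τ : ℝ) : ℝ :=
  √(n : ℝ) * f (quantile F τ) * (√(1 - τ))⁻¹

end

end Frontier

/-!
# Asymptotic normality of intermediate conditional quantile estimators

The sample objective is convex in `q`, and its right derivative at `y` is the sum of the scores
`(1{Yᵢ ≤ y} - τ) 1{Xᵢ ≤ x}`. Hence a minimizer is at most `y` when this sum is positive, and only
when it is nonnegative (`le_of_sum_score_pos`, `sum_score_nonneg_of_le`). The distribution function
of the normalized estimator at `t` is thereby squeezed between the probabilities that a sum of
i.i.d. bounded variables, the scores at `y = q(τₙ) + t / λₙ`, is positive and that it is nonnegative.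

A score has mean `p₀ (F(y) - τₙ)` and second moment equivalent to `p₀ (1 - τₙ)`. After division by
`√(n (1 - τₙ))`, a central limit theorem for bounded triangular arrays
(`tendstoInDistribution_sum_triangular`, by characteristic functions) gives the limit `N(p₀ t, p₀)`,
provided that `√n (1 - τₙ)^{-1/2} (F(y) - τₙ) → t`. The limit has no atom at `0` and is nonnegative
with the probability that `N(0, 1/p₀)` is at most `t`.

The remaining increment of `F` (`tendsto_rescaled_increment`) is where the tail assumptions enter.
By the monotone density theorem (`tendsto_mul_density_div`), `z f(w) / (1 - F(z₁ - z)) → -1/ξ`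
whenever `z₁ - w ∼ z`. This shows that `λₙ (z₁ - q(τₙ))` is of order `√(n (1 - τₙ)) → ∞`, so that
`q(τₙ)` and `q(τₙ) + t / λₙ` are asymptotically equidistant from `z₁`, and then that
`f(q(τₙ) + t / λₙ) / f(q(τₙ)) → 1`. As `f` is monotone, the increment is `f(q(τₙ)) t / λₙ` up to a
factor tending to `1`.
-/

namespace Frontier

/-! ### Monotone densities and regular variation -/

/-- The slope of `s ↦ s ^ α` between `v` and `v ^ 2` tends to the derivative `α` at `1`. -/
lemma tendsto_rpow_sq_sub_div (α : ℝ) :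
    Tendsto (fun v : ℝ => ((v * v) ^ α - v ^ α) / (v * v - v)) (𝓝[≠] 1) (𝓝 α) := by
  have h1 : HasDerivAt (fun v : ℝ => v ^ α) α 1 := by
    simpa using Real.hasDerivAt_rpow_const (x := 1) (p := α) (Or.inl one_ne_zero)
  have h2 := hasDerivAt_iff_tendsto_slope.1 h1
  have h3 : Tendsto (fun v : ℝ => v ^ α / v) (𝓝[≠] 1) (𝓝 1) := by
    have : ContinuousAt (fun v : ℝ => v ^ α / v) 1 := h1.continuousAt.div continuousAt_id one_ne_zero
    simpa using this.tendsto.mono_left nhdsWithin_le_nhds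
  have h4 := h3.mul h2
  rw [one_mul] at h4
  refine h4.congr' ?_
  filter_upwards [self_mem_nhdsWithin, mem_nhdsWithin_of_mem_nhds (lt_mem_nhds one_pos)] with v hv h0
  have hv' : v - 1 ≠ 0 := sub_ne_zero.2 hv
  rw [slope_def_field, Real.one_rpow, Real.mul_rpow h0.le h0.le]
  have : v * v - v ≠ 0 := by
    have : v * v - v = v * (v - 1) := by ring
    rw [this]; exact mul_ne_zero h0.ne' hv'
  field_simp

lemma mul_mem_uIcc_mul {a b u : ℝ} (c : ℝ) (h : u ∈ Set.uIcc a b) :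
    c * u ∈ Set.uIcc (c * a) (c * b) := by
  rw [← Set.image_const_mul_uIcc]
  exact ⟨u, h, rfl⟩

/-- **Monotone density theorem** at a finite endpoint: if `1 - F (z₁ - ·)` is regularly varying at
`0` of index `α` and each value `f w` lies between a slope of `F` to the left of `w` and one to the
right, then `z f(w) / (1 - F (z₁ - z)) → α` as `z ↓ 0`, uniformly over `z₁ - w ∼ z`. -/
lemma tendsto_mul_density_div {F f : ℝ → ℝ} {z₁ y₀ α : ℝ} (hy₀ : y₀ < z₁)
    (hreg : ∀ v : ℝ, 0 < v →
      Tendsto (fun z => (1 - F (z₁ - v * z)) / (1 - F (z₁ - z))) (𝓝[>] 0) (𝓝 (v ^ α)))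
    (hslope : ∀ a b w c d, y₀ ≤ a → a < b → b ≤ w → w ≤ c → c < d → d < z₁ →
      f w ∈ Set.uIcc (slope F a b) (slope F c d))
    {ι : Type*} {L : Filter ι} {z w : ι → ℝ} (hz : Tendsto z L (𝓝[>] 0))
    (hw : Tendsto (fun n => (z₁ - w n) / z n) L (𝓝 1)) :
    Tendsto (fun n => z n / (1 - F (z₁ - z n)) * f (w n)) L (𝓝 α) := by
  set Q : ℝ → ℝ := fun v => ((v * v) ^ α - v ^ α) / (v * v - v) with hQ
  set A : ℝ → ι → ℝ := fun v n =>
    z n / (1 - F (z₁ - z n)) * slope F (z₁ - v * v * z n) (z₁ - v * z n) with hA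
  have hzpos : ∀ᶠ n in L, 0 < z n := hz.eventually self_mem_nhdsWithin
  have hz0 : Tendsto z L (𝓝 0) := hz.mono_right nhdsWithin_le_nhds
  have hAlim : ∀ v : ℝ, 0 < v → v ≠ 1 → Tendsto (A v) L (𝓝 (Q v)) := by
    intro v hv hv1
    have h := (((hreg (v * v) (by positivity)).comp hz).sub ((hreg v hv).comp hz)).div_const
      (v * v - v)
    refine h.congr' ?_
    filter_upwards [hzpos] with n hn
    have : v * v - v ≠ 0 := by
      have : v * v - v = v * (v - 1) := by ring
      rw [this]; exact mul_ne_zero hv.ne' (sub_ne_zero.2 hv1)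
    simp only [Function.comp, hA, slope_def_field]
    rw [show z₁ - v * z n - (z₁ - v * v * z n) = (v * v - v) * z n by ring, ← sub_div]
    by_cases hG : 1 - F (z₁ - z n) = 0
    · simp [hG]
    · field_simp
      ring
  have hQ1 : Tendsto Q (𝓝[>] 1) (𝓝 α) :=
    (tendsto_rpow_sq_sub_div α).mono_left (nhdsWithin_mono _ fun x (hx : 1 < x) => hx.ne')
  have hQ2 : Tendsto (fun v => Q v⁻¹) (𝓝[>] 1) (𝓝 α) := by
    refine (tendsto_rpow_sq_sub_div α).comp (tendsto_nhdsWithin_iff.2 ⟨?_, ?_⟩)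
    · have : ContinuousAt (fun v : ℝ => v⁻¹) 1 := continuousAt_inv₀ one_ne_zero
      simpa using this.tendsto.mono_left nhdsWithin_le_nhds
    · filter_upwards [self_mem_nhdsWithin] with v hv
      exact (inv_lt_one_of_one_lt₀ hv).ne
  rw [Metric.tendsto_nhds]
  intro ε hε
  -- a common ratio `v > 1` for which both limiting slopes are within `ε / 2` of `α`
  obtain ⟨v, ⟨hv1, hv2⟩, hv : 1 < v⟩ := (((Metric.tendsto_nhds.1 hQ1 (ε / 2) (half_pos hε)).and
    (Metric.tendsto_nhds.1 hQ2 (ε / 2) (half_pos hε))).and self_mem_nhdsWithin).exists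
  have hv0 : 0 < v := one_pos.trans hv
  have hvi : v⁻¹ < 1 := inv_lt_one_of_one_lt₀ hv
  have hvi0 : 0 < v⁻¹ := inv_pos.2 hv0
  have h1 := Metric.tendsto_nhds.1 (hAlim v hv0 hv.ne') (ε / 2) (half_pos hε)
  have h2 := Metric.tendsto_nhds.1 (hAlim v⁻¹ hvi0 hvi.ne) (ε / 2) (half_pos hε)
  have h3 : ∀ᶠ n in L, y₀ < z₁ - v * v * z n := by
    have : Tendsto (fun n => z₁ - v * v * z n) L (𝓝 z₁) := by
      simpa using (hz0.const_mul (v * v)).const_sub z₁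
    exact this.eventually (lt_mem_nhds hy₀)
  filter_upwards [h1, h2, h3, hzpos, hw.eventually (lt_mem_nhds hvi), hw.eventually (gt_mem_nhds hv)]
    with n h1 h2 h3 hzn hw1 hw2
  rw [lt_div_iff₀ hzn] at hw1
  rw [div_lt_iff₀ hzn] at hw2
  have hvv : v * z n < v * v * z n := by nlinarith [mul_pos hv0 hzn]
  have hvvi : v⁻¹ * v⁻¹ * z n < v⁻¹ * z n := by nlinarith [mul_pos hvi0 hzn]
  have hmem := mul_mem_uIcc_mul (z n / (1 - F (z₁ - z n)))
    (hslope (z₁ - v * v * z n) (z₁ - v * z n) (w n) (z₁ - v⁻¹ * z n) (z₁ - v⁻¹ * v⁻¹ * z n)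
      h3.le (by linarith) (by linarith) (by linarith) (by linarith)
      (by have : 0 < v⁻¹ * v⁻¹ * z n := by positivity
          linarith))
  rw [slope_comm F (z₁ - v⁻¹ * z n)] at hmem
  change _ ∈ Set.uIcc (A v n) (A v⁻¹ n) at hmem
  have hAv : A v n ∈ Metric.ball α ε := by
    have := dist_triangle (A v n) (Q v) α
    rw [Metric.mem_ball]; linarith
  have hAvi : A v⁻¹ n ∈ Metric.ball α ε := by
    have := dist_triangle (A v⁻¹ n) (Q v⁻¹) α
    rw [Metric.mem_ball]; linarith
  have hord : Set.OrdConnected (Metric.ball α ε) := by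
    rw [Real.ball_eq_Ioo]; exact Set.ordConnected_Ioo
  exact hord.uIcc_subset hAv hAvi hmem

/-- `F` has a monotone density `f` on `[y₀, z₁)`, nondecreasing or nonincreasing, expressed without
integrals: `f` is monotone and the increments of `F` lie between the products of the length of the
interval with the values of `f` at its endpoints. -/
def HasMonotoneDensityOn (F f : ℝ → ℝ) (y₀ z₁ : ℝ) : Prop :=
  (∀ a b, y₀ ≤ a → a ≤ b → b < z₁ →
    f a ≤ f b ∧ (b - a) * f a ≤ F b - F a ∧ F b - F a ≤ (b - a) * f b) ∨
  (∀ a b, y₀ ≤ a → a ≤ b → b < z₁ →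
    f b ≤ f a ∧ (b - a) * f b ≤ F b - F a ∧ F b - F a ≤ (b - a) * f a)

lemma HasMonotoneDensityOn.mem_uIcc_slope {F f : ℝ → ℝ} {y₀ z₁ : ℝ}
    (h : HasMonotoneDensityOn F f y₀ z₁) {a b w c d : ℝ} (ha : y₀ ≤ a) (hab : a < b) (hbw : b ≤ w)
    (hwc : w ≤ c) (hcd : c < d) (hd : d < z₁) :
    f w ∈ Set.uIcc (slope F a b) (slope F c d) := by
  have hab' := sub_pos.2 hab
  have hcd' := sub_pos.2 hcd
  rw [slope_def_field, slope_def_field, Set.mem_uIcc]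
  rcases h with h | h
  · left
    rw [div_le_iff₀ hab', le_div_iff₀ hcd']
    obtain ⟨-, -, h1⟩ := h a b ha hab.le (by linarith)
    obtain ⟨h2, -, -⟩ := h b w (by linarith) hbw (by linarith)
    obtain ⟨h3, -, -⟩ := h w c (by linarith) hwc (by linarith)
    obtain ⟨-, h4, -⟩ := h c d (by linarith) hcd.le hd
    constructor <;> nlinarith
  · right
    rw [div_le_iff₀ hcd', le_div_iff₀ hab']
    obtain ⟨-, h1, -⟩ := h a b ha hab.le (by linarith)
    obtain ⟨h2, -, -⟩ := h b w (by linarith) hbw (by linarith)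
    obtain ⟨h3, -, -⟩ := h w c (by linarith) hwc (by linarith)
    obtain ⟨-, -, h4⟩ := h c d (by linarith) hcd.le hd
    constructor <;> nlinarith

/-- First-order expansion of `F`, in both directions, with the oscillation of `f` as error. -/
lemma HasMonotoneDensityOn.abs_sub_sub_le {F f : ℝ → ℝ} {y₀ z₁ : ℝ}
    (h : HasMonotoneDensityOn F f y₀ z₁) {a b : ℝ} (ha : a ∈ Set.Ico y₀ z₁)
    (hb : b ∈ Set.Ico y₀ z₁) :
    |F b - F a - (b - a) * f a| ≤ |b - a| * |f b - f a| := by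
  rw [← abs_mul]
  rcases le_total a b with hab | hab
  · rcases h with h | h <;> obtain ⟨h1, h2, h3⟩ := h a b ha.1 hab hb.2
    · rw [abs_of_nonneg (by linarith), abs_of_nonneg (by nlinarith)]; linarith
    · rw [abs_of_nonpos (by linarith), abs_of_nonpos (by nlinarith)]; linarith
  · rcases h with h | h <;> obtain ⟨h1, h2, h3⟩ := h b a hb.1 hab ha.2
    · rw [abs_of_nonneg (by linarith), abs_of_nonneg (by nlinarith)]; linarith
    · rw [abs_of_nonpos (by linarith), abs_of_nonpos (by nlinarith)]; linarith

/-! ### A central limit theorem for bounded triangular arrays -/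

/-- Second-order Taylor expansion of the characteristic function of a bounded random variable, with
an error controlled by the bound and the second moment. -/
lemma norm_charFun_map_sub_le {Ω : Type*} [MeasurableSpace Ω] {P : Measure Ω}
    [IsProbabilityMeasure P] {U : Ω → ℝ} (hU : Measurable U) {b : ℝ} (hb : ∀ ω, |U ω| ≤ b) (t : ℝ) :
    ‖charFun (P.map U) t - 1 - (t * (∫ ω, U ω ∂P) * Complex.I - t ^ 2 / 2 * (∫ ω, U ω ^ 2 ∂P))‖
      ≤ |t| ^ 3 * Real.exp (|t| * b) * b * ∫ ω, U ω ^ 2 ∂P := by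
  have hUb : ∀ᵐ ω ∂P, ‖U ω‖ ≤ b := ae_of_all _ hb
  have hI1 : Integrable U P := Integrable.of_bound hU.aestronglyMeasurable b hUb
  have hI2 : Integrable (fun ω => U ω ^ 2) P :=
    Integrable.of_bound (hU.pow_const 2).aestronglyMeasurable (b ^ 2) (ae_of_all _ fun ω => by
      rw [norm_pow]; exact pow_le_pow_left₀ (norm_nonneg _) (hb ω) 2)
  have hIe : Integrable (fun ω => Complex.exp (t * U ω * Complex.I)) P := by
    refine Integrable.of_bound (by fun_prop) 1 (ae_of_all _ fun ω => ?_)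
    rw [← Complex.ofReal_mul, Complex.norm_exp_ofReal_mul_I]
  have hC1 : Integrable (fun ω => (t * U ω * Complex.I : ℂ)) P :=
    (hI1.ofReal.const_mul _).mul_const _
  have hC2 : Integrable (fun ω => (t ^ 2 / 2 * (U ω ^ 2 : ℝ) : ℂ)) P := hI2.ofReal.const_mul _
  have hchar : charFun (P.map U) t = ∫ ω, Complex.exp (t * U ω * Complex.I) ∂P := by
    rw [charFun_apply_real, integral_map hU.aemeasurable (by fun_prop)]
  have hrepr : charFun (P.map U) t - 1 -
        (t * (∫ ω, U ω ∂P) * Complex.I - t ^ 2 / 2 * (∫ ω, U ω ^ 2 ∂P)) =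
      ∫ ω, (Complex.exp (t * U ω * Complex.I) - 1 -
        (t * U ω * Complex.I - t ^ 2 / 2 * (U ω ^ 2 : ℝ))) ∂P := by
    have hE : Integrable (fun ω => Complex.exp (t * U ω * Complex.I) - 1) P :=
      hIe.sub (integrable_const _)
    have hC : Integrable (fun ω => (t * U ω * Complex.I - t ^ 2 / 2 * (U ω ^ 2 : ℝ) : ℂ)) P :=
      hC1.sub hC2
    rw [integral_sub hE hC,
      integral_sub hIe (integrable_const _), integral_sub hC1 hC2, hchar]
    congr 2
    · simp
    · rw [integral_mul_const, integral_const_mul, integral_complex_ofReal]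
    · rw [integral_const_mul, integral_complex_ofReal]
  rw [hrepr]
  rw [← integral_const_mul]
  refine norm_integral_le_of_norm_le (hI2.const_mul _) (ae_of_all _ fun ω => ?_)
  have h := Complex.norm_exp_sub_sum_le_norm_mul_exp (t * U ω * Complex.I) 3
  have hn : ‖(t * U ω * Complex.I : ℂ)‖ = |t| * |U ω| := by simp
  rw [hn] at h
  have hs : Complex.exp (t * U ω * Complex.I) - 1 -
      (t * U ω * Complex.I - t ^ 2 / 2 * (U ω ^ 2 : ℝ)) = Complex.exp (t * U ω * Complex.I) -
        ∑ m ∈ Finset.range 3, (t * U ω * Complex.I) ^ m / (m.factorial : ℂ) := by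
    simp only [Finset.sum_range_succ, Finset.sum_range_zero, Nat.factorial]
    push_cast
    rw [mul_pow _ Complex.I 2, Complex.I_sq]
    ring
  rw [hs]
  refine h.trans ?_
  have h0 : |U ω| ^ 3 ≤ b * U ω ^ 2 := by
    rw [← sq_abs (U ω), pow_succ']
    exact mul_le_mul_of_nonneg_right (hb ω) (sq_nonneg _)
  calc (|t| * |U ω|) ^ 3 * Real.exp (|t| * |U ω|)
      ≤ (|t| ^ 3 * (b * U ω ^ 2)) * Real.exp (|t| * b) := by
        rw [mul_pow]
        have hbU := hb ω
        have hb0 : 0 ≤ b := (abs_nonneg _).trans hbU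
        gcongr
    _ = _ := by ring

/-- **Central limit theorem for bounded triangular arrays**: the rows are i.i.d. and bounded by a
null sequence, and the mean and the second moment of the row sums converge. -/
theorem tendstoInDistribution_sum_triangular {Ω : Type*} [MeasurableSpace Ω] {P : Measure Ω}
    [IsProbabilityMeasure P] {U : ℕ → ℕ → Ω → ℝ} (hU : ∀ n i, Measurable (U n i))
    (hindep : ∀ n, iIndepFun (U n) P) (hident : ∀ n i, IdentDistrib (U n i) (U n 0) P P)
    {b : ℕ → ℝ} (hb : ∀ n ω, |U n 0 ω| ≤ b n) (hb0 : Tendsto b atTop (𝓝 0))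
    {m : ℝ} {v : NNReal} (hm : Tendsto (fun n : ℕ => n * ∫ ω, U n 0 ω ∂P) atTop (𝓝 m))
    (hv : Tendsto (fun n : ℕ => n * ∫ ω, U n 0 ω ^ 2 ∂P) atTop (𝓝 v)) :
    TendstoInDistribution (fun n ω => ∑ i ∈ Finset.range n, U n i ω) atTop (id : ℝ → ℝ)
      (fun _ => P) (gaussianReal m v) where
  forall_aemeasurable n := (Finset.measurable_fun_sum _ fun i _ => hU n i).aemeasurable
  tendsto := by
    refine ProbabilityMeasure.tendsto_iff_tendsto_charFun.2 fun t => ?_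
    have hlaw (n : ℕ) : charFun (P.map fun ω => ∑ i ∈ Finset.range n, U n i ω) t =
        (1 + (charFun (P.map (U n 0)) t - 1)) ^ n := by
      rw [((hindep n).restrict _).charFun_map_fun_finsetSum_eq_prod
        (fun i _ => (hU n i).aemeasurable)]
      simp [fun i => (hident n i).map_eq]
    simp only [ProbabilityMeasure.coe_mk, hlaw, Measure.map_id, charFun_gaussianReal]
    refine Complex.tendsto_one_add_pow_exp_of_tendsto ?_
    have hmain : Tendsto (fun n : ℕ => (t * ((n * ∫ ω, U n 0 ω ∂P : ℝ) : ℂ) * Complex.I -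
        t ^ 2 / 2 * ((n * ∫ ω, U n 0 ω ^ 2 ∂P : ℝ) : ℂ))) atTop
        (𝓝 (t * (m : ℂ) * Complex.I - t ^ 2 / 2 * ((v : ℝ) : ℂ))) :=
      ((((Complex.continuous_ofReal.tendsto _).comp hm).const_mul _).mul_const _).sub
        (((Complex.continuous_ofReal.tendsto _).comp hv).const_mul _)
    have hbound : Tendsto (fun n : ℕ => |t| ^ 3 * Real.exp (|t| * b n) * b n *
        (n * ∫ ω, U n 0 ω ^ 2 ∂P)) atTop (𝓝 0) := by
      have h1 : Tendsto (fun n => Real.exp (|t| * b n)) atTop (𝓝 (Real.exp (|t| * 0))) :=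
        (Real.continuous_exp.tendsto _).comp (hb0.const_mul _)
      simpa using (((h1.const_mul (|t| ^ 3)).mul hb0).mul hv)
    have hdiff := squeeze_zero_norm (fun n : ℕ => ?_) hbound
      (f := fun n : ℕ => n * (charFun (P.map (U n 0)) t - 1) -
        (t * ((n * ∫ ω, U n 0 ω ∂P : ℝ) : ℂ) * Complex.I -
        t ^ 2 / 2 * ((n * ∫ ω, U n 0 ω ^ 2 ∂P : ℝ) : ℂ)))
    · have := hdiff.add hmain
      simp only [sub_add_cancel, zero_add] at this
      convert this using 2
      ring
    · have h := norm_charFun_map_sub_le (P := P) (hU n 0) (hb n) t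
      calc _ = ‖(n : ℂ) * (charFun (P.map (U n 0)) t - 1 - (t * (∫ ω, U n 0 ω ∂P) * Complex.I -
              t ^ 2 / 2 * (∫ ω, U n 0 ω ^ 2 ∂P)))‖ := by
            congr 1; push_cast; ring
        _ ≤ n * (|t| ^ 3 * Real.exp (|t| * b n) * b n * ∫ ω, U n 0 ω ^ 2 ∂P) := by
            rw [norm_mul, Complex.norm_natCast]
            gcongr
        _ = _ := by ring

/-- Pointwise convergence of the distribution functions implies convergence in distribution. -/
lemma tendstoInDistribution_of_tendsto_measureReal_le {Ω : Type*} [MeasurableSpace Ω]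
    {P : Measure Ω} [IsProbabilityMeasure P] {V : ℕ → Ω → ℝ} (hV : ∀ n, AEMeasurable (V n) P)
    {ν : Measure ℝ} [IsProbabilityMeasure ν]
    (h : ∀ t, Tendsto (fun n => P.real {ω | V n ω ≤ t}) atTop (𝓝 (ν.real (Set.Iic t)))) :
    TendstoInDistribution V atTop (id : ℝ → ℝ) (fun _ => P) ν where
  forall_aemeasurable := hV
  tendsto := by
    refine IsPiSystem.tendsto_probabilityMeasure_of_tendsto_of_mem
      (S := {S | ∃ a b : ℝ, a < b ∧ Set.Ioc a b = S}) ?_ ?_ ?_ ?_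
    · exact isPiSystem_Ioc id id
    · rintro _ ⟨a, b, -, rfl⟩
      exact measurableSet_Ioc
    · intro u hu x hx
      obtain ⟨ε, hε, hball⟩ := Metric.isOpen_iff.1 hu x hx
      refine ⟨_, ⟨x - ε / 2, x + ε / 2, by linarith, rfl⟩, Ioc_mem_nhds (by linarith) (by linarith),
        fun y hy => hball ?_⟩
      rw [Real.ball_eq_Ioo]
      exact ⟨by linarith [hy.1], by linarith [hy.2]⟩
    · rintro _ ⟨a, b, hab, rfl⟩
      have hIoc (ρ : Measure ℝ) [IsProbabilityMeasure ρ] :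
          ρ.real (Set.Ioc a b) = ρ.real (Set.Iic b) - ρ.real (Set.Iic a) := by
        rw [← Set.Iic_sdiff_Iic, measureReal_sdiff (Set.Iic_subset_Iic.2 hab.le) measurableSet_Iic]
      have hmap (n : ℕ) (t : ℝ) : (P.map (V n)).real (Set.Iic t) = P.real {ω | V n ω ≤ t} := by
        rw [map_measureReal_apply_of_aemeasurable (hV n) measurableSet_Iic]
        rfl
      have key : Tendsto (fun n => (P.map (V n)).real (Set.Ioc a b)) atTop
          (𝓝 (ν.real (Set.Ioc a b))) := by
        have hp (n : ℕ) := Measure.isProbabilityMeasure_map (hV n)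
        simp_rw [hIoc, hmap]
        exact (h b).sub (h a)
      rw [← NNReal.tendsto_coe]
      rw [← Measure.map_id (μ := ν)] at key
      exact key

/-! ### Sample quantiles -/

/-- `1{Y ≤ q} - τ` is a subgradient at `q` of the convex function `q ↦ check τ (Y - q)`. -/
lemma check_add_mul_le (τ Y q q' : ℝ) :
    check τ (Y - q) + ((if Y ≤ q then 1 else 0) - τ) * (q' - q) ≤ check τ (Y - q') := by
  unfold check
  split_ifs <;> nlinarith

open Classical in
/-- The contribution `(1{Y ≤ y} - τ) 1{X ≤ x}` of one observation to the right derivative at `y` of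
the sample objective. -/
noncomputable def score {d : ℕ} (x : Fin d → ℝ) (τ y : ℝ) (p : (Fin d → ℝ) × ℝ) : ℝ :=
  ((if p.2 ≤ y then 1 else 0) - τ) * if p.1 ≤ x then 1 else 0

section Minimizer

variable {Ω : Type*} {d : ℕ} {X : ℕ → Ω → Fin d → ℝ} {Y : ℕ → Ω → ℝ} {x : Fin d → ℝ} {n : ℕ}
  {τ : ℝ} {ω : Ω} {y q : ℝ}

/-- The sum of the scores at `y` is a subgradient at `y` of the sample objective. -/
lemma sampleObjective_add_mul_le (y q : ℝ) :
    sampleObjective X Y x n τ ω y + (∑ i ∈ Finset.range n, score x τ y (X i ω, Y i ω)) * (q - y) ≤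
      sampleObjective X Y x n τ ω q := by
  unfold sampleObjective score
  rw [Finset.sum_mul, ← Finset.sum_add_distrib]
  refine Finset.sum_le_sum fun i _ => ?_
  have h := check_add_mul_le τ (Y i ω) y q
  dsimp only
  by_cases hx : X i ω ≤ x
  · simpa [hx] using h
  · simp [hx]

/-- The right derivative of the sample objective is right continuous. -/
lemma eventually_sum_score_eq (y : ℝ) :
    ∀ᶠ y' in 𝓝[>] y, ∑ i ∈ Finset.range n, score x τ y' (X i ω, Y i ω) =
      ∑ i ∈ Finset.range n, score x τ y (X i ω, Y i ω) := by
  have h : ∀ᶠ y' in 𝓝[>] y, ∀ i ∈ Finset.range n, (Y i ω ≤ y' ↔ Y i ω ≤ y) := by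
    refine (Filter.eventually_all_finset _).2 fun i _ => ?_
    rcases le_or_gt (Y i ω) y with hi | hi
    · filter_upwards [self_mem_nhdsWithin] with y' hy'
      exact ⟨fun _ => hi, fun _ => hi.trans (le_of_lt hy')⟩
    · filter_upwards [mem_nhdsWithin_of_mem_nhds (gt_mem_nhds hi)] with y' hy'
      exact ⟨fun h => absurd h (not_le.2 hy'), fun h => absurd h (not_le.2 hi)⟩
  filter_upwards [h] with y' hy'
  refine Finset.sum_congr rfl fun i hi => ?_
  simp only [score, hy' i hi]

/-- At a point on or to the right of a minimizer the right derivative of the sample objective is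
nonnegative. The subgradient inequality gives this strictly to the right of the minimizer; right
continuity extends it to the minimizer itself. -/
lemma sum_score_nonneg_of_le
    (hq : ∀ r, sampleObjective X Y x n τ ω q ≤ sampleObjective X Y x n τ ω r) (hqy : q ≤ y) :
    0 ≤ ∑ i ∈ Finset.range n, score x τ y (X i ω, Y i ω) := by
  obtain ⟨y', hy', hlt⟩ :=
    ((eventually_sum_score_eq (X := X) (Y := Y) (x := x) (n := n) (τ := τ) (ω := ω) y).and
      self_mem_nhdsWithin).exists
  have hlt : y < y' := hlt
  rw [← hy']
  have h1 := sampleObjective_add_mul_le (X := X) (Y := Y) (x := x) (n := n) (τ := τ) (ω := ω) y' q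
  have h2 := hq y'
  by_contra hneg
  nlinarith [mul_pos_of_neg_of_neg (not_le.1 hneg) (sub_neg.2 (hqy.trans_lt hlt))]

lemma le_of_sum_score_pos
    (hq : ∀ r, sampleObjective X Y x n τ ω q ≤ sampleObjective X Y x n τ ω r)
    (hpos : 0 < ∑ i ∈ Finset.range n, score x τ y (X i ω, Y i ω)) : q ≤ y := by
  have h1 := sampleObjective_add_mul_le (X := X) (Y := Y) (x := x) (n := n) (τ := τ) (ω := ω) y q
  have h2 := hq y
  by_contra hlt
  nlinarith [mul_pos hpos (sub_pos.2 (not_le.1 hlt))]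

end Minimizer

/-! ### Moments of the score -/

lemma measurable_score {d : ℕ} (x : Fin d → ℝ) (τ y : ℝ) : Measurable (score x τ y) := by
  classical
  refine Measurable.mul ((Measurable.ite ?_ measurable_const measurable_const).sub_const _)
    (Measurable.ite ?_ measurable_const measurable_const)
  · exact measurableSet_le measurable_snd measurable_const
  · exact measurable_fst measurableSet_Iic

lemma abs_score_le {d : ℕ} (x : Fin d → ℝ) (τ y : ℝ) (p : (Fin d → ℝ) × ℝ) :
    |score x τ y p| ≤ 1 + |τ| := by
  have h1 := neg_abs_le τ
  have h2 := le_abs_self τ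
  unfold score
  split_ifs <;> rw [abs_le] <;> constructor <;> linarith

section Moments

variable {Ω : Type*} [MeasurableSpace Ω] {P : Measure Ω} [IsProbabilityMeasure P] {d : ℕ}
  {X : Ω → Fin d → ℝ} {Y : Ω → ℝ} {x : Fin d → ℝ}

lemma measureReal_inter_eq_mul_condDistFun (hX : Measurable X) (y : ℝ) :
    P.real ({ω | X ω ≤ x} ∩ {ω | Y ω ≤ y}) =
      P.real {ω | X ω ≤ x} * condDistFun P X Y x y := by
  have hB : MeasurableSet {ω | X ω ≤ x} := hX measurableSet_Iic
  rw [condDistFun, Measure.real, Measure.real, Measure.real, ← cond_mul_eq_inter hB,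
    ENNReal.toReal_mul, mul_comm]

/-- Integral of a function of the observation that takes the value `c₁` on `{X ≤ x, Y ≤ y}`, the
value `c₂` on `{X ≤ x, y < Y}` and vanishes elsewhere. -/
lemma integral_of_eq_indicator (hX : Measurable X) (hY : Measurable Y) {g : Ω → ℝ} (c₁ c₂ y : ℝ)
    (hg : ∀ ω, g ω = (c₁ - c₂) * ({ω | X ω ≤ x} ∩ {ω | Y ω ≤ y}).indicator 1 ω +
      c₂ * {ω | X ω ≤ x}.indicator 1 ω) :
    ∫ ω, g ω ∂P = P.real {ω | X ω ≤ x} *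
      (c₁ * condDistFun P X Y x y + c₂ * (1 - condDistFun P X Y x y)) := by
  have hB : MeasurableSet {ω | X ω ≤ x} := hX measurableSet_Iic
  have hA : MeasurableSet {ω | Y ω ≤ y} := hY measurableSet_Iic
  have hi (S : Set Ω) (hS : MeasurableSet S) : Integrable (S.indicator (1 : Ω → ℝ)) P :=
    (integrable_const (1 : ℝ)).indicator hS
  simp_rw [hg]
  rw [integral_add ((hi _ (hB.inter hA)).const_mul _) ((hi _ hB).const_mul _), integral_const_mul,
    integral_const_mul, integral_indicator_one (hB.inter hA), integral_indicator_one hB,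
    measureReal_inter_eq_mul_condDistFun hX]
  ring

lemma integral_score (hX : Measurable X) (hY : Measurable Y) (τ y : ℝ) :
    ∫ ω, score x τ y (X ω, Y ω) ∂P =
      P.real {ω | X ω ≤ x} * (condDistFun P X Y x y - τ) := by
  rw [integral_of_eq_indicator hX hY (1 - τ) (-τ) y (x := x)]
  · ring
  · intro ω
    by_cases h1 : X ω ≤ x <;> by_cases h2 : Y ω ≤ y <;> simp [score, h1, h2, sub_eq_add_neg]

lemma integral_score_sq (hX : Measurable X) (hY : Measurable Y) (τ y : ℝ) :
    ∫ ω, score x τ y (X ω, Y ω) ^ 2 ∂P = P.real {ω | X ω ≤ x} *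
      ((1 - τ) ^ 2 * condDistFun P X Y x y + τ ^ 2 * (1 - condDistFun P X Y x y)) := by
  refine integral_of_eq_indicator hX hY ((1 - τ) ^ 2) (τ ^ 2) y fun ω => ?_
  by_cases h1 : X ω ≤ x <;> by_cases h2 : Y ω ≤ y <;> simp [score, h1, h2]

end Moments

/-! ### The conditional distribution function -/

section CondLaw

variable {Ω : Type*} [MeasurableSpace Ω] {P : Measure Ω} [IsProbabilityMeasure P] {d : ℕ}
  {X : Ω → Fin d → ℝ} {Y : Ω → ℝ} {x : Fin d → ℝ} {f : ℝ → ℝ}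

lemma isProbabilityMeasure_map_cond (hY : Measurable Y) (hp : 0 < P.real {ω | X ω ≤ x}) :
    IsProbabilityMeasure ((P[|{ω | X ω ≤ x}]).map Y) := by
  have : P {ω | X ω ≤ x} ≠ 0 := fun h => by simp [Measure.real, h] at hp
  have := cond_isProbabilityMeasure this
  exact Measure.isProbabilityMeasure_map hY.aemeasurable

omit [IsProbabilityMeasure P] in
lemma condDistFun_eq_map (hY : Measurable Y) (y : ℝ) :
    condDistFun P X Y x y = ((P[|{ω | X ω ≤ x}]).map Y).real (Set.Iic y) := by
  rw [map_measureReal_apply hY measurableSet_Iic]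
  rfl

lemma condDistFun_eq_cdf (hY : Measurable Y) (hp : 0 < P.real {ω | X ω ≤ x}) :
    condDistFun P X Y x = cdf ((P[|{ω | X ω ≤ x}]).map Y) := by
  have := isProbabilityMeasure_map_cond hY hp
  ext y
  rw [condDistFun_eq_map hY, cdf_eq_real]

lemma IsCondDensity.condDistFun_sub (hf : IsCondDensity P X Y x f) (hY : Measurable Y)
    (hp : 0 < P.real {ω | X ω ≤ x}) {a b : ℝ} (hab : a ≤ b) :
    ENNReal.ofReal (condDistFun P X Y x b - condDistFun P X Y x a) =
      ∫⁻ y in Set.Ioc a b, ENNReal.ofReal (f y) := by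
  have := isProbabilityMeasure_map_cond hY hp
  rw [← withDensity_apply _ measurableSet_Ioc, ← hf.2.2, condDistFun_eq_map hY,
    condDistFun_eq_map hY, ← measureReal_sdiff (Set.Iic_subset_Iic.2 hab) measurableSet_Iic,
    Set.Iic_sdiff_Iic, ofReal_measureReal]

lemma IsCondDensity.mul_le_condDistFun_sub (hf : IsCondDensity P X Y x f) (hY : Measurable Y)
    (hp : 0 < P.real {ω | X ω ≤ x}) {a b c : ℝ} (hab : a ≤ b) (hc : ∀ y ∈ Set.Ioo a b, c ≤ f y) :
    (b - a) * c ≤ condDistFun P X Y x b - condDistFun P X Y x a := by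
  have hF : condDistFun P X Y x a ≤ condDistFun P X Y x b := by
    rw [condDistFun_eq_cdf hY hp]; exact monotone_cdf _ hab
  rw [← ENNReal.ofReal_le_ofReal_iff (sub_nonneg.2 hF), hf.condDistFun_sub hY hp hab,
    setLIntegral_congr Ioo_ae_eq_Ioc.symm, ENNReal.ofReal_mul (sub_nonneg.2 hab), mul_comm,
    ← Real.volume_Ioo, ← setLIntegral_const]
  exact setLIntegral_mono' measurableSet_Ioo fun y hy => ENNReal.ofReal_le_ofReal (hc y hy)

lemma IsCondDensity.condDistFun_sub_le_mul (hf : IsCondDensity P X Y x f) (hY : Measurable Y)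
    (hp : 0 < P.real {ω | X ω ≤ x}) {a b c : ℝ} (hab : a ≤ b) (hc0 : 0 ≤ c)
    (hc : ∀ y ∈ Set.Ioo a b, f y ≤ c) :
    condDistFun P X Y x b - condDistFun P X Y x a ≤ (b - a) * c := by
  rw [← ENNReal.ofReal_le_ofReal_iff (mul_nonneg (sub_nonneg.2 hab) hc0),
    hf.condDistFun_sub hY hp hab,
    setLIntegral_congr Ioo_ae_eq_Ioc.symm, ENNReal.ofReal_mul (sub_nonneg.2 hab), mul_comm,
    ← Real.volume_Ioo, ← setLIntegral_const]
  exact setLIntegral_mono' measurableSet_Ioo fun y hy => ENNReal.ofReal_le_ofReal (hc y hy)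

lemma IsCondDensity.hasMonotoneDensityOn (hf : IsCondDensity P X Y x f) (hY : Measurable Y)
    (hp : 0 < P.real {ω | X ω ≤ x}) {y₀ z₁ : ℝ}
    (h : MonotoneOn f (Set.Ico y₀ z₁) ∨ AntitoneOn f (Set.Ico y₀ z₁)) :
    HasMonotoneDensityOn (condDistFun P X Y x) f y₀ z₁ := by
  refine h.imp (fun h a b ha hab hb => ?_) (fun h a b ha hab hb => ?_)
  all_goals
    have ha' : a ∈ Set.Ico y₀ z₁ := ⟨ha, hab.trans_lt hb⟩
    have hb' : b ∈ Set.Ico y₀ z₁ := ⟨ha.trans hab, hb⟩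
    have hy' (y) (hy : y ∈ Set.Ioo a b) : y ∈ Set.Ico y₀ z₁ :=
      ⟨ha.trans hy.1.le, hy.2.trans hb⟩
    refine ⟨h ha' hb' hab, hf.mul_le_condDistFun_sub hY hp hab fun y hy => ?_,
      hf.condDistFun_sub_le_mul hY hp hab (hf.2.1 _) fun y hy => ?_⟩
  · exact h ha' (hy' y hy) hy.1.le
  · exact h (hy' y hy) hb' hy.2.le
  · exact h (hy' y hy) hb' hy.2.le
  · exact h ha' (hy' y hy) hy.1.le

lemma IsCondDensity.continuous_condDistFun (hf : IsCondDensity P X Y x f) (hY : Measurable Y)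
    (hp : 0 < P.real {ω | X ω ≤ x}) : Continuous (condDistFun P X Y x) := by
  have := isProbabilityMeasure_map_cond hY hp
  have hatom (y : ℝ) : (P[|{ω | X ω ≤ x}]).map Y {y} = 0 := by
    rw [hf.2.2]; exact measure_singleton y
  rw [condDistFun_eq_cdf hY hp]
  set G := cdf ((P[|{ω | X ω ≤ x}]).map Y) with hG
  refine continuous_iff_continuousAt.2 fun y => continuousAt_iff_continuous_left'_right'.2
    ⟨G.mono.continuousWithinAt_Iio_iff_leftLim_eq.2 ?_,
      (G.right_continuous y).mono Set.Ioi_subset_Ici_self⟩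
  have h := hatom y
  rw [← measure_cdf ((P[|{ω | X ω ≤ x}]).map Y), StieltjesFunction.measure_singleton,
    ENNReal.ofReal_eq_zero] at h
  exact le_antisymm (G.mono.leftLim_le le_rfl) (sub_nonpos.1 h)

end CondLaw

/-! ### Intermediate quantiles -/

/-- A continuous distribution function attains the level `τ` at its `τ`-quantile. -/
lemma apply_quantile_eq {F : ℝ → ℝ} (hF : Continuous F) (h0 : Tendsto F atBot (𝓝 0))
    (h1 : Tendsto F atTop (𝓝 1)) {τ : ℝ} (hτ0 : 0 < τ) (hτ1 : τ < 1) : F (quantile F τ) = τ := by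
  have hne : {y | τ ≤ F y}.Nonempty := (h1.eventually (le_mem_nhds hτ1)).exists
  obtain ⟨l, hl⟩ := eventually_atBot.1 (h0.eventually (gt_mem_nhds hτ0))
  have hbdd : BddBelow {y | τ ≤ F y} := ⟨l, fun y hy => by
    by_contra h
    exact absurd (hl y (not_le.1 h).le) (not_lt.2 hy)⟩
  have hcl : IsClosed {y | τ ≤ F y} := isClosed_le continuous_const hF
  refine le_antisymm ?_ (hcl.csInf_mem hne hbdd)
  have hlt : ∀ᶠ y in 𝓝[<] quantile F τ, F y ≤ τ := by
    filter_upwards [self_mem_nhdsWithin] with y hy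
    exact (not_le.1 fun h => absurd (csInf_le hbdd h) (not_le.2 hy)).le
  exact le_of_tendsto ((hF.tendsto _).mono_left nhdsWithin_le_nhds) hlt

lemma IsIntermediate.tendsto_mul_atTop {τ : ℕ → ℝ} (hτ : IsIntermediate τ) :
    Tendsto (fun n : ℕ => n * (1 - τ n)) atTop atTop := by
  obtain ⟨-, δ, hδ, c, hc, h⟩ := hτ
  exact tendsto_atTop_mono' _ h
    (((tendsto_rpow_atTop hδ).comp tendsto_natCast_atTop_atTop).const_mul_atTop hc)

lemma IsIntermediate.eventually_lt_one {τ : ℕ → ℝ} (hτ : IsIntermediate τ) :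
    ∀ᶠ n in atTop, τ n < 1 := by
  filter_upwards [hτ.tendsto_mul_atTop.eventually_gt_atTop 0] with n hn
  exact sub_pos.1 (pos_of_mul_pos_right hn n.cast_nonneg)

section UpperEndpoint

variable {F : ℝ → ℝ} {y : ℝ}

lemma lt_upperEndpoint (hF : Continuous F) (hb : BddAbove {z | F z < 1}) (hy : F y < 1) :
    y < upperEndpoint F := by
  obtain ⟨y', hy', hlt⟩ := (((hF.tendsto y).eventually (gt_mem_nhds hy)).filter_mono
    nhdsWithin_le_nhds |>.and (self_mem_nhdsWithin (s := Set.Ioi y))).exists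
  exact lt_of_lt_of_le hlt (le_csSup hb hy')

lemma apply_lt_one_of_lt_upperEndpoint (hF : Monotone F) (h0 : Tendsto F atBot (𝓝 0))
    (hy : y < upperEndpoint F) : F y < 1 := by
  have hne : {z | F z < 1}.Nonempty := (h0.eventually (gt_mem_nhds one_pos)).exists
  obtain ⟨z, hz, hyz⟩ := exists_lt_of_lt_csSup hne hy
  exact (hF hyz.le).trans_lt hz

end UpperEndpoint

section Quantile

variable {F f : ℝ → ℝ} {τ : ℕ → ℝ} {ξ y₀ : ℝ}

lemma tendsto_upperEndpoint_sub_quantile (hFm : Monotone F) (hFc : Continuous F)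
    (h0 : Tendsto F atBot (𝓝 0)) (h1 : Tendsto F atTop (𝓝 1)) (hb : BddAbove {z | F z < 1})
    (hτ : IsIntermediate τ) :
    Tendsto (fun n => upperEndpoint F - quantile F (τ n)) atTop (𝓝[>] 0) := by
  have hFq : ∀ᶠ n in atTop, F (quantile F (τ n)) = τ n := by
    filter_upwards [hτ.1.eventually (lt_mem_nhds one_pos), hτ.eventually_lt_one] with n ha hb
    exact apply_quantile_eq hFc h0 h1 ha hb
  have hlt : ∀ᶠ n in atTop, quantile F (τ n) < upperEndpoint F := by
    filter_upwards [hFq, hτ.eventually_lt_one] with n ha hn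
    exact lt_upperEndpoint hFc hb (ha.trans_lt hn)
  refine tendsto_nhdsWithin_iff.2 ⟨?_, hlt.mono fun n hn => sub_pos.2 hn⟩
  have : Tendsto (fun n => quantile F (τ n)) atTop (𝓝 (upperEndpoint F)) := by
    refine tendsto_order.2 ⟨fun y hy => ?_, fun y hy => hlt.mono fun n hn => hn.trans hy⟩
    have hFy := apply_lt_one_of_lt_upperEndpoint hFm h0 hy
    filter_upwards [hτ.1.eventually (lt_mem_nhds hFy), hFq] with n hn hq
    by_contra hle
    exact absurd (hFm (not_lt.1 hle)) (by rw [hq]; exact not_le.2 hn)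
  simpa using this.const_sub (upperEndpoint F)

/-- A shift of the intermediate quantile by `t` units of the reciprocal rate changes `F` by
`t (1 - τ)^{1/2} n^{-1/2}`, up to lower order terms: the density is asymptotically constant on this
scale, by the monotone density theorem. The rate is eventually positive. -/
theorem tendsto_rescaled_increment (hFm : Monotone F) (hFc : Continuous F)
    (h0 : Tendsto F atBot (𝓝 0)) (h1 : Tendsto F atTop (𝓝 1)) (hev : InTypeIIIDomain F ξ)
    (hy₀ : y₀ < upperEndpoint F) (hd : HasMonotoneDensityOn F f y₀ (upperEndpoint F))
    (hτ : IsIntermediate τ) (t : ℝ) :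
    (∀ᶠ n in atTop, 0 < rate F f n (τ n)) ∧
    Tendsto (fun n : ℕ => √(n : ℝ) / √(1 - τ n) *
      (F (quantile F (τ n) + t / rate F f n (τ n)) - τ n)) atTop (𝓝 t) := by
  obtain ⟨hξ, hb, hreg⟩ := hev
  have hα : 0 < -1 / ξ := div_pos_of_neg_of_neg (by norm_num) hξ
  set α := -1 / ξ
  set z₁ := upperEndpoint F with hz₁
  set q : ℕ → ℝ := fun n => quantile F (τ n) with hq
  set r : ℕ → ℝ := fun n => rate F f n (τ n) with hr
  have hz : Tendsto (fun n => z₁ - q n) atTop (𝓝[>] 0) :=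
    tendsto_upperEndpoint_sub_quantile hFm hFc h0 h1 hb hτ
  have hz0 : Tendsto (fun n => z₁ - q n) atTop (𝓝 0) := hz.mono_right nhdsWithin_le_nhds
  have hzpos : ∀ᶠ n in atTop, 0 < z₁ - q n := hz.eventually self_mem_nhdsWithin
  have hFq : ∀ᶠ n in atTop, F (q n) = τ n := by
    filter_upwards [hτ.1.eventually (lt_mem_nhds one_pos), hτ.eventually_lt_one] with n ha hb
    exact apply_quantile_eq hFc h0 h1 ha hb
  -- the monotone density theorem along `z₁ - q n`
  have hdens (w : ℕ → ℝ) (hw : Tendsto (fun n => (z₁ - w n) / (z₁ - q n)) atTop (𝓝 1)) :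
      Tendsto (fun n => (z₁ - q n) / (1 - τ n) * f (w n)) atTop (𝓝 α) := by
    have h := tendsto_mul_density_div (f := f) hy₀ hreg
      (fun a b w c d => hd.mem_uIcc_slope) hz hw
    refine h.congr' ?_
    filter_upwards [hFq] with n hn
    rw [sub_sub_cancel, hn]
  have hDq := hdens q (tendsto_const_nhds.congr' (by
    filter_upwards [hzpos] with n hn
    exact (div_self hn.ne').symm))
  have hfq : ∀ᶠ n in atTop, 0 < f (q n) := by
    filter_upwards [hDq.eventually (lt_mem_nhds hα), hzpos, hτ.eventually_lt_one] with n h1 h2 h3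
    exact pos_of_mul_pos_right h1 (div_pos h2 (sub_pos.2 h3)).le
  have hrpos : ∀ᶠ n in atTop, 0 < r n := by
    filter_upwards [hfq, hτ.eventually_lt_one, eventually_gt_atTop 0] with n h1 h2 h3
    have h2' := sub_pos.2 h2
    have h3' : (0 : ℝ) < n := Nat.cast_pos.2 h3
    simp only [hr, rate]
    positivity
  refine ⟨hrpos, ?_⟩
  have hsqrt : Tendsto (fun n : ℕ => √(n * (1 - τ n))) atTop atTop :=
    Real.tendsto_sqrt_atTop.comp hτ.tendsto_mul_atTop
  have hrz : Tendsto (fun n => r n * (z₁ - q n)) atTop atTop := by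
    refine (hsqrt.atTop_mul_pos hα hDq).congr' ?_
    filter_upwards [hτ.eventually_lt_one] with n hn
    have h2 := sub_pos.2 hn
    simp only [hr, rate, Real.sqrt_mul n.cast_nonneg]
    have h3 := Real.sqrt_pos.2 h2
    have h4 := Real.mul_self_sqrt h2.le
    generalize √(1 - τ n) = s at *
    rw [← h4]
    field_simp
    rfl
  set y : ℕ → ℝ := fun n => q n + t / r n with hy
  have hyz : Tendsto (fun n => (z₁ - y n) / (z₁ - q n)) atTop (𝓝 1) := by
    have h : Tendsto (fun n => 1 - t / (r n * (z₁ - q n))) atTop (𝓝 (1 - 0)) :=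
      (hrz.const_div_atTop t).const_sub 1
    rw [sub_zero] at h
    refine h.congr' ?_
    filter_upwards [hzpos] with n hn
    rw [← div_div, eq_div_iff hn.ne', sub_mul, div_mul_cancel₀ _ hn.ne']
    simp only [hy]; ring
  have hDy := hdens y hyz
  have hratio : Tendsto (fun n => f (y n) / f (q n)) atTop (𝓝 1) := by
    have h := hDy.div hDq hα.ne'
    rw [div_self hα.ne'] at h
    refine h.congr' ?_
    filter_upwards [hzpos, hτ.eventually_lt_one] with n h1 h2
    exact mul_div_mul_left _ _ (div_pos h1 (sub_pos.2 h2)).ne'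
  have hmem (w : ℕ → ℝ) (hw : Tendsto (fun n => (z₁ - w n) / (z₁ - q n)) atTop (𝓝 1)) :
      ∀ᶠ n in atTop, w n ∈ Set.Ico y₀ z₁ := by
    have h : Tendsto (fun n => (z₁ - w n) / (z₁ - q n) * (z₁ - q n)) atTop (𝓝 (1 * 0)) :=
      hw.mul hz0
    rw [mul_zero] at h
    filter_upwards [hzpos, h.eventually (gt_mem_nhds (sub_pos.2 hy₀)),
      hw.eventually (lt_mem_nhds one_pos)] with n h1 h2 h3
    rw [div_mul_cancel₀ _ h1.ne'] at h2
    have := (div_pos_iff_of_pos_right h1).1 h3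
    exact ⟨by linarith, by linarith⟩
  have hqmem := hmem q (tendsto_const_nhds.congr' (by
    filter_upwards [hzpos] with n hn
    exact (div_self hn.ne').symm))
  have hbound : Tendsto (fun n => |t| * |f (y n) / f (q n) - 1|) atTop (𝓝 0) := by
    simpa using ((hratio.sub_const 1).abs).const_mul |t|
  rw [tendsto_iff_norm_sub_tendsto_zero]
  refine squeeze_zero' (Eventually.of_forall fun n => norm_nonneg _) ?_ hbound
  filter_upwards [hqmem, hmem y hyz, hFq, hfq, hrpos, hτ.eventually_lt_one,
    eventually_gt_atTop 0] with n hqn hyn hFqn hfqn hrn hτn hn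
  have h := hd.abs_sub_sub_le hqn hyn
  have hc : 0 < √(n : ℝ) / √(1 - τ n) :=
    div_pos (Real.sqrt_pos.2 (Nat.cast_pos.2 hn)) (Real.sqrt_pos.2 (sub_pos.2 hτn))
  have hrc : r n = √(n : ℝ) / √(1 - τ n) * f (q n) := by
    simp only [hr, rate, hq]; ring
  generalize √(n : ℝ) / √(1 - τ n) = c at *
  have hyq : y n - q n = t / r n := by simp [hy]
  have hct : c * ((y n - q n) * f (q n)) = t := by
    rw [hyq, hrc]; field_simp
  rw [hFqn] at h
  calc ‖c * (F (y n) - τ n) - t‖ = c * |F (y n) - τ n - (y n - q n) * f (q n)| := by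
        rw [← abs_of_pos hc, ← abs_mul, abs_of_pos hc, mul_sub c (F (y n) - τ n), hct,
          Real.norm_eq_abs]
    _ ≤ c * (|y n - q n| * |f (y n) - f (q n)|) := by gcongr
    _ = |c * ((y n - q n) * f (q n))| * |f (y n) / f (q n) - 1| := by
        rw [div_sub_one hfqn.ne', abs_div, abs_mul, abs_mul, abs_of_pos hc, abs_of_pos hfqn]
        field_simp
    _ = _ := by rw [hct]

end Quantile

/-! ### Asymptotic normality -/

/-- `p₀ t - p₀ U` has law `N(p₀ t, p₀)` when `U` has law `N(0, p₀⁻¹)`. -/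
lemma gaussianReal_Ici_zero_eq {p₀ : ℝ} (hp : 0 < p₀) (t : ℝ) :
    (gaussianReal (p₀ * t) p₀.toNNReal).real (Set.Ici 0) =
      (gaussianReal 0 p₀⁻¹.toNNReal).real (Set.Iic t) := by
  have h1 : ((gaussianReal 0 p₀⁻¹.toNNReal).map (p₀ * ·)).map (p₀ * t - ·) =
      gaussianReal (p₀ * t) p₀.toNNReal := by
    rw [gaussianReal_map_const_mul, gaussianReal_map_const_sub]
    congr 1
    · simp
    · ext
      simp only [NNReal.coe_mul, NNReal.coe_mk, Real.coe_toNNReal _ hp.le,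
        Real.coe_toNNReal _ (inv_pos.2 hp).le]
      field_simp
  rw [← h1, map_measureReal_apply (by fun_prop) measurableSet_Ici,
    map_measureReal_apply (by fun_prop) (measurableSet_Ici.preimage (by fun_prop))]
  congr 1
  ext u
  simp [hp, mul_div_cancel_left₀ t hp.ne']

/-- The portmanteau theorem for continuity sets, in terms of random variables. -/
lemma TendstoInDistribution.tendsto_measureReal {Ω : Type*} [MeasurableSpace Ω]
    {P : Measure Ω} [IsProbabilityMeasure P] {V : ℕ → Ω → ℝ} {ν : Measure ℝ}
    [IsProbabilityMeasure ν] (h : TendstoInDistribution V atTop (id : ℝ → ℝ) (fun _ => P) ν)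
    {S : Set ℝ} (hS : MeasurableSet S) (hfr : ν (frontier S) = 0) :
    Tendsto (fun n => P.real {ω | V n ω ∈ S}) atTop (𝓝 (ν.real S)) := by
  have h1 := ProbabilityMeasure.tendsto_measure_of_null_frontier_of_tendsto' h.tendsto (E := S)
    (by simpa using hfr)
  simp only [ProbabilityMeasure.coe_mk, Measure.map_id] at h1
  refine ((ENNReal.tendsto_toReal (measure_ne_top ν S)).comp h1).congr fun n => ?_
  exact congrArg ENNReal.toReal (Measure.map_apply_of_aemeasurable (h.forall_aemeasurable n) hS)

section Score

variable {Ω : Type*} [MeasurableSpace Ω] {P : Measure Ω} [IsProbabilityMeasure P] {d : ℕ}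
  {X : ℕ → Ω → Fin d → ℝ} {Y : ℕ → Ω → ℝ} {x : Fin d → ℝ}

/-- Asymptotic normality of the normalized sum of scores at levels `y n` whose distance to the
quantile is of the order of the reciprocal rate. A single score has mean `p₀ (F (y n) - τ n)` and
second moment `p₀ (1 - τ n) (1 + o(1))`. -/
theorem tendstoInDistribution_sum_score (hX : ∀ i, Measurable (X i)) (hY : ∀ i, Measurable (Y i))
    (hindep : iIndepFun (fun i ω => (X i ω, Y i ω)) P)
    (hident : ∀ i, IdentDistrib (fun ω => (X i ω, Y i ω)) (fun ω => (X 0 ω, Y 0 ω)) P P)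
    {τ y : ℕ → ℝ} (hτ : IsIntermediate τ) {t : ℝ}
    (hy : Tendsto (fun n : ℕ => √(n : ℝ) / √(1 - τ n) *
      (condDistFun P (X 0) (Y 0) x (y n) - τ n)) atTop (𝓝 t)) :
    TendstoInDistribution
      (fun n ω => (√(n * (1 - τ n)))⁻¹ *
        ∑ i ∈ Finset.range n, score x (τ n) (y n) (X i ω, Y i ω)) atTop (id : ℝ → ℝ)
      (fun _ => P) (gaussianReal (P.real {ω | X 0 ω ≤ x} * t)
        (P.real {ω | X 0 ω ≤ x}).toNNReal) := by
  have hsqrt : Tendsto (fun n : ℕ => (√(n * (1 - τ n)))⁻¹) atTop (𝓝 0) :=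
    (Real.tendsto_sqrt_atTop.comp hτ.tendsto_mul_atTop).inv_tendsto_atTop
  have hmeas (n : ℕ) :
      Measurable fun p => (√(n * (1 - τ n)))⁻¹ * score x (τ n) (y n) p :=
    (measurable_score x _ _).const_mul _
  have hpos : ∀ᶠ n : ℕ in atTop, (0 : ℝ) < n ∧ 0 < 1 - τ n := by
    filter_upwards [eventually_gt_atTop 0, hτ.eventually_lt_one] with n h1 h2
    exact ⟨Nat.cast_pos.2 h1, sub_pos.2 h2⟩
  simp_rw [Finset.mul_sum]
  refine tendstoInDistribution_sum_triangular
    (U := fun n i ω => (√(n * (1 - τ n)))⁻¹ * score x (τ n) (y n) (X i ω, Y i ω))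
    (b := fun n => (√(n * (1 - τ n)))⁻¹ * (1 + |τ n|))
    (fun n i => (hmeas n).comp ((hX i).prodMk (hY i)))
    (fun n => hindep.comp _ fun _ => hmeas n) (fun n i => (hident i).comp (hmeas n))
    (fun n ω => ?_) ?_ ?_ ?_
  · rw [abs_mul, abs_of_nonneg (inv_nonneg.2 (Real.sqrt_nonneg _))]
    exact mul_le_mul_of_nonneg_left (abs_score_le _ _ _ _) (inv_nonneg.2 (Real.sqrt_nonneg _))
  · simpa using hsqrt.mul (hτ.1.abs.const_add 1)
  · refine (hy.const_mul (P.real {ω | X 0 ω ≤ x})).congr' ?_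
    filter_upwards [hpos] with n ⟨hn, hτn⟩
    rw [integral_const_mul, integral_score (hX 0) (hY 0), Real.sqrt_mul hn.le]
    have h1 := Real.sqrt_pos.2 hn
    have h2 := Real.sqrt_pos.2 hτn
    have h3 := Real.mul_self_sqrt hn.le
    generalize √(n : ℝ) = s at *
    rw [← h3]
    field_simp
  · rw [Real.coe_toNNReal _ measureReal_nonneg]
    -- the tail ratio `(1 - F (y n)) / (1 - τ n)` tends to `1`
    have hr := (hy.mul hsqrt).const_sub 1
    have hτ1 := hτ.1.const_sub 1
    simp only [mul_zero, sub_zero, sub_self] at hr hτ1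
    have hlim := ((hτ1.mul ((hτ1.mul hr).const_sub 1)).add ((hτ.1.pow 2).mul hr)).const_mul
      (P.real {ω | X 0 ω ≤ x})
    simp only [zero_mul, one_pow, mul_one, zero_add] at hlim
    refine hlim.congr' ?_
    filter_upwards [hpos] with n ⟨hn, hτn⟩
    simp_rw [mul_pow]
    rw [integral_const_mul, integral_score_sq (hX 0) (hY 0), Real.sqrt_mul hn.le]
    set F := condDistFun P (X 0) (Y 0) x (y n)
    have h1 := Real.sqrt_pos.2 hn
    have h2 := Real.sqrt_pos.2 hτn
    have hR : 1 - √(n : ℝ) / √(1 - τ n) * (F - τ n) * (√(n : ℝ) * √(1 - τ n))⁻¹ =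
        (1 - F) / (1 - τ n) := by
      have h4 := Real.mul_self_sqrt hτn.le
      have : √(n : ℝ) / √(1 - τ n) * (F - τ n) * (√(n : ℝ) * √(1 - τ n))⁻¹ =
          (F - τ n) / (√(1 - τ n) * √(1 - τ n)) := by field_simp
      rw [this, h4]
      field_simp
      ring
    rw [hR, inv_pow, mul_pow, Real.sq_sqrt hn.le, Real.sq_sqrt hτn.le]
    field_simp
    ring

end Score

end Frontier

theorem mainTheorem8 {Ω : Type*} [MeasurableSpace Ω] (P : Measure Ω) [IsProbabilityMeasure P]
    {d : ℕ} (X : ℕ → Ω → Fin d → ℝ) (Y : ℕ → Ω → ℝ) (x : Fin d → ℝ)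
    -- the observations are i.i.d. and `p₀ = P(X ≤ x) > 0`
    (hX : ∀ i, Measurable (X i)) (hY : ∀ i, Measurable (Y i))
    (hindep : iIndepFun (fun i ω => (X i ω, Y i ω)) P)
    (hident : ∀ i, IdentDistrib (fun ω => (X i ω, Y i ω)) (fun ω => (X 0 ω, Y 0 ω)) P P)
    (p₀ : ℝ) (hp₀ : p₀ = P.real {ω | X 0 ω ≤ x}) (hp₀_pos : 0 < p₀)
    -- the conditional distribution function lies in a type III domain of attraction
    (F : ℝ → ℝ) (hF : F = Frontier.condDistFun P (X 0) (Y 0) x)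
    (ξ : ℝ) (hev : Frontier.InTypeIIIDomain F ξ)
    -- it has a density that is monotone in the upper tail
    (f : ℝ → ℝ) (hf : Frontier.IsCondDensity P (X 0) (Y 0) x f)
    (hmono : Frontier.EventuallyMonotoneBelow f (Frontier.upperEndpoint F))
    -- the quantile indices are of intermediate order
    (τ : ℕ → ℝ) (hτ : Frontier.IsIntermediate τ)
    -- `qhat n` is any (measurable) minimizer of the sample objective
    (qhat : ℕ → Ω → ℝ) (hqhat_meas : ∀ n, AEMeasurable (qhat n) P)
    (hqhat : ∀ᶠ n in atTop, ∀ᵐ ω ∂P, ∀ q : ℝ,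
      Frontier.sampleObjective X Y x n (τ n) ω (qhat n ω) ≤
        Frontier.sampleObjective X Y x n (τ n) ω q) :
    TendstoInDistribution
      (fun n ω => Frontier.rate F f n (τ n) * (qhat n ω - Frontier.quantile F (τ n)))
      atTop (id : ℝ → ℝ) (fun _ => P) (gaussianReal 0 (Real.toNNReal p₀⁻¹)) := by
  obtain ⟨y₀, hy₀, hmon⟩ := hmono
  have hp : 0 < P.real {ω | X 0 ω ≤ x} := hp₀ ▸ hp₀_pos
  have hd := hf.hasMonotoneDensityOn (hY 0) hp hmon
  have hcdf := Frontier.condDistFun_eq_cdf (X := X 0) (x := x) (hY 0) hp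
  have hFm : Monotone F := by rw [hF, hcdf]; exact monotone_cdf _
  have hFc : Continuous F := by rw [hF]; exact hf.continuous_condDistFun (hY 0) hp
  have h0 : Tendsto F atBot (𝓝 0) := by rw [hF, hcdf]; exact tendsto_cdf_atBot _
  have h1 : Tendsto F atTop (𝓝 1) := by rw [hF, hcdf]; exact tendsto_cdf_atTop _
  rw [← hF] at hd
  refine Frontier.tendstoInDistribution_of_tendsto_measureReal_le
    (fun n => ((hqhat_meas n).sub_const _).const_mul _) fun t => ?_
  obtain ⟨hrate, hincr⟩ := Frontier.tendsto_rescaled_increment hFm hFc h0 h1 hev hy₀ hd hτ t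
  rw [hF] at hincr
  have hS := Frontier.tendstoInDistribution_sum_score hX hY hindep hident hτ hincr
  rw [← hF, ← hp₀] at hS
  have hv : p₀.toNNReal ≠ 0 := (Real.toNNReal_pos.2 hp₀_pos).ne'
  have hna := nullSingletonClass_gaussianReal (μ := p₀ * t) hv
  have hfr1 : gaussianReal (p₀ * t) p₀.toNNReal (frontier (Set.Ici 0)) = 0 := by
    rw [frontier_Ici]; exact measure_singleton _
  have hfr2 : gaussianReal (p₀ * t) p₀.toNNReal (frontier (Set.Ioi 0)) = 0 := by
    rw [frontier_Ioi]; exact measure_singleton _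
  -- a minimizer is at most `y` if the sum of the scores at `y` is positive, and only if that sum is
  -- nonnegative; the two events have the same limiting probability
  have hle := Frontier.TendstoInDistribution.tendsto_measureReal hS measurableSet_Ici hfr1
  have hge := Frontier.TendstoInDistribution.tendsto_measureReal hS measurableSet_Ioi hfr2
  rw [measureReal_congr Ioi_ae_eq_Ici] at hge
  rw [Frontier.gaussianReal_Ici_zero_eq hp₀_pos] at hle hge
  refine tendsto_of_tendsto_of_tendsto_of_le_of_le' hge hle ?_ ?_
  all_goals
    filter_upwards [hqhat, hrate, hτ.tendsto_mul_atTop.eventually_gt_atTop 0]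
      with n hmin hrn hn
    have ha : 0 < (√(n * (1 - τ n)))⁻¹ := inv_pos.2 (Real.sqrt_pos.2 hn)
    refine ENNReal.toReal_mono (measure_ne_top _ _) (measure_mono_ae ?_)
    filter_upwards [hmin] with ω hω hmem
  · have hmem : 0 < (√(n * (1 - τ n)))⁻¹ * ∑ i ∈ Finset.range n, Frontier.score x (τ n)
        (Frontier.quantile F (τ n) + t / Frontier.rate F f n (τ n)) (X i ω, Y i ω) := hmem
    have := Frontier.le_of_sum_score_pos hω (pos_of_mul_pos_right hmem ha.le)
    change _ * _ ≤ _
    rw [mul_comm, ← le_div_iff₀ hrn]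
    linarith
  · have hmem : _ * _ ≤ _ := hmem
    rw [mul_comm, ← le_div_iff₀ hrn] at hmem
    exact mul_nonneg ha.le (Frontier.sum_score_nonneg_of_le hω (by linarith))
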